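/- Let $\mathcal C$ be a semi-abelian category (a pointed, Barr exact, Bourn protomodular category with finite coproducts). A normal monomorphism is a kernel of some morphism, and a protosplit normal monomorphism is a kernel of a split epimorphism; $K\lhd X$ means that $K$ is a normal subobject of $X$. Morphisms $f\colon A\to D$, $g\colon B\to D$ commute if there is $\varphi\colon A\times B\to D$ with $\varphi\langle 1_A,0\rangle=f$ and $\varphi\langle 0,1_B\rangle=g$. For subobjects $k\colon K\to X$, $l\colon L\to X$, the Huq commutator $[K,L]_X$ is the smallest normal subobject $N\lhd X$ such that the composites of $k$ and $l$ with the quotient $X\to X/N$ commute, and the Higgins commutator $[K,L]\le X$ is the image of the composite $K\diamond L\to K+L\to X$, where $K\diamond L$ is the kernel of the canonical morphism $K+L\to K\times L$ and $K+L\to X$ is induced by $k$ and $l$. The category $\mathcal C$ satisfies (NH) if $[K,L]\lhd X$ for all $X$ and all $K,L\lhd X$. For an object $Z$, $\mathsf{Pt}_Z(\mathcal C)$ is the category of points over $Z$ (objects $Y$ with morphisms $f\colon Y\to Z$, $s\colon Z\to Y$, $fs=1_Z$), and $\mathrm{Ker}\colon\mathsf{Pt}_Z(\mathcal C)\to\mathcal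 C$ sends $(Y,f,s)$ to the kernel of $f$. **Theorem.** The Huq commutator $[K,L]_X$ exists for all subobjects $K,L\le X$ in $\mathcal C$, and the following are equivalent: (i) $\mathcal C$ satisfies (NH); (ii) for all $K,L\le X\le Y$ with $K,L\lhd Y$: $[K,L]_X=[K,L]_Y$; (iii) for all $K,L\le X\lhd Y$ with $K,L\lhd Y$: $[K,L]_X=[K,L]_Y$; (iv) for all $K,L\le X\le Y$ with $X$ protosplit normal in $Y$ and $K,L\lhd Y$: $[K,L]_X=[K,L]_Y$; (v) for all $K,L\le X\lhd Y$ with $K,L\lhd Y$ and $X=K\vee L$: $[K,L]_X=[K,L]_Y$; (vi) for all $K,L\le X\le Y$ with $X$ protosplit normal in $Y$, $K,L\lhd Y$ and $X=K\vee L$: $[K,L]_X=[K,L]_Y$; (vii) for every object $Z$, every point $(Y,f,s)$ over $Z$ with kernel $X=\mathrm{Ker}(Y,f,s)$, and all normal subobjects $K',L'\lhd Y$ in $\mathsf{Pt}_Z(\mathcal C)$ with kernels $K=\mathrm{Ker}(K')\le X$ and $L=\mathrm{Ker}(L')\le X$, there is a normal subobject $N\lhd Y$ in $\mathsf{Pt}_Z(\mathcal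 C)$ such that $\mathrm{Ker}(N)=[K,L]_X$ as subobjects of $X$; (viii) the same as (vii), only for those $Y,K',L'$ for which $X=K\vee L$. -/

import Mathlib

open CategoryTheory CategoryTheory.Limits

universe v u

noncomputable section

namespace HuqHiggins

section Basic

variable {C : Type u} [Category.{v} C] [HasZeroMorphisms C]

/-- `k` is a kernel of `p`. -/
def IsKernelOf {K A B : C} (k : K ⟶ A) (p : A ⟶ B) : Prop :=
  ∃ w : k ≫ p = 0, Nonempty (IsLimit (KernelFork.ofι k w))

/-- `q` is a cokernel of `n`. -/
def IsCokernelOf {N X Q : C} (q : X ⟶ Q) (n : N ⟶ X) : Prop :=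
  ∃ w : n ≫ q = 0, Nonempty (IsColimit (CokernelCofork.ofπ q w))

/-- A normal monomorphism: a kernel of some morphism. -/
def IsNormalMono {A B : C} (f : A ⟶ B) : Prop :=
  ∃ (D : C) (g : B ⟶ D), IsKernelOf f g

/-- A protosplit normal monomorphism: a kernel of some split epimorphism. -/
def IsProtosplitMono {A B : C} (f : A ⟶ B) : Prop :=
  ∃ (D : C) (g : B ⟶ D), IsSplitEpi g ∧ IsKernelOf f g

/-- A normal subobject. -/
def IsNormalSubobject {X : C} (N : Subobject X) : Prop :=
  IsNormalMono N.arrow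

end Basic

/-- A semi-abelian category: it has a zero object and finite coproducts, it is Barr exact
(regular, and every internal equivalence relation is a kernel pair), and it is protomodular,
which for a pointed category with finite limits is the split short five lemma.
The zero morphisms are a parameter, but a category has at most one such structure, and it is
the one given by the zero object. -/
class SemiAbelian (C : Type u) [Category.{v} C] [HasZeroMorphisms C] : Prop
    extends Regular C where
  hasZeroObject : HasZeroObject C
  hasFiniteCoproducts : HasFiniteCoproducts C
  effective : ∀ {R X : C} (p₁ p₂ : R ⟶ X), IsEquivalenceRelation p₁ p₂ →
    ∃ (Y : C) (f : X ⟶ Y), IsKernelPair f p₁ p₂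
  split_short_five : ∀ {K A B K' A' B' : C}
    (k : K ⟶ A) (p : A ⟶ B) (s : B ⟶ A) (k' : K' ⟶ A') (p' : A' ⟶ B') (s' : B' ⟶ A')
    (a : K ⟶ K') (b : A ⟶ A') (c : B ⟶ B'),
    IsKernelOf k p → s ≫ p = 𝟙 B → IsKernelOf k' p' → s' ≫ p' = 𝟙 B' →
    k ≫ b = a ≫ k' → p ≫ c = b ≫ p' → s ≫ b = c ≫ s' →
    IsIso a → IsIso c → IsIso b

attribute [instance] SemiAbelian.hasZeroObject SemiAbelian.hasFiniteCoproducts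

section Commutators

variable {C : Type u} [Category.{v} C] [HasZeroMorphisms C] [SemiAbelian C]

/-- Two morphisms with the same codomain commute (cooperate). -/
def Cooperate {A B D : C} (f : A ⟶ D) (g : B ⟶ D) : Prop :=
  ∃ φ : A ⨯ B ⟶ D, prod.lift (𝟙 A) 0 ≫ φ = f ∧ prod.lift 0 (𝟙 B) ≫ φ = g

/-- `K` and `L` commute in the quotient `X / N`. -/
def CooperateModulo {X : C} (K L N : Subobject X) : Prop :=
  ∃ (Q : C) (q : X ⟶ Q), IsCokernelOf q N.arrow ∧ Cooperate (K.arrow ≫ q) (L.arrow ≫ q)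

/-- `N` is the Huq commutator of `K` and `L` in `X`: the smallest normal subobject of `X`
such that `K` and `L` commute in the quotient `X / N`. -/
def IsHuqCommutator {X : C} (K L N : Subobject X) : Prop :=
  IsLeast {M : Subobject X | IsNormalSubobject M ∧ CooperateModulo K L M} N

open Classical in
/-- The Huq commutator `[K, L]_X`. -/
def huqCommutator {X : C} (K L : Subobject X) : Subobject X :=
  if h : ∃ N, IsHuqCommutator K L N then h.choose else ⊤

/-- The canonical comparison morphism `A + B ⟶ A × B`. -/
def coprodToProd (A B : C) : A ⨿ B ⟶ A ⨯ B :=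
  coprod.desc (prod.lift (𝟙 A) 0) (prod.lift 0 (𝟙 B))

/-- The Higgins commutator `[K, L]`: the image in `X` of the kernel `K ⋄ L` of
`K + L ⟶ K × L` under the morphism `K + L ⟶ X` induced by the two inclusions. -/
def higginsCommutator {X : C} (K L : Subobject X) : Subobject X :=
  imageSubobject (kernel.ι (coprodToProd (K : C) (L : C)) ≫ coprod.desc K.arrow L.arrow)

variable (C) in
/-- Normality of Higgins commutators. -/
def ConditionNH : Prop :=
  ∀ (X : C) (K L : Subobject X), IsNormalSubobject K → IsNormalSubobject L →
    IsNormalSubobject (higginsCommutator K L)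

end Commutators

section Points

variable {C : Type u} [Category.{v} C]

/-- A point over `Z`: a split epimorphism to `Z` together with a chosen section. -/
structure Pt (Z : C) where
  obj : C
  p : obj ⟶ Z
  s : Z ⟶ obj
  section_eq : s ≫ p = 𝟙 Z

namespace Pt

variable {Z : C}

/-- A morphism of points over `Z`. -/
@[ext]
structure Hom (P Q : Pt Z) where
  hom : P.obj ⟶ Q.obj
  comp_p : hom ≫ Q.p = P.p
  s_comp : P.s ≫ hom = Q.s

instance : Category (Pt Z) where
  Hom P Q := Hom P Q
  id P := ⟨𝟙 P.obj, by simp, by simp⟩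
  comp f g := ⟨f.hom ≫ g.hom, by simp [f.comp_p, g.comp_p],
    by rw [← Category.assoc, f.s_comp, g.s_comp]⟩

@[simp] theorem id_hom (P : Pt Z) : Hom.hom (𝟙 P) = 𝟙 P.obj := rfl

@[simp] theorem comp_hom {P Q R : Pt Z} (f : P ⟶ Q) (g : Q ⟶ R) :
    Hom.hom (f ≫ g) = Hom.hom f ≫ Hom.hom g := rfl

theorem hom_ext {P Q : Pt Z} {f g : P ⟶ Q} (h : Hom.hom f = Hom.hom g) : f = g :=
  Hom.ext h

/-- The zero morphisms of `Pt Z`: those that factor through the zero object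
`(Z, 𝟙 Z, 𝟙 Z)`. -/
instance : HasZeroMorphisms (Pt Z) where
  zero P Q := ⟨⟨P.p ≫ Q.s, by simp [Q.section_eq], by
    rw [← Category.assoc, P.section_eq, Category.id_comp]⟩⟩
  comp_zero f R := hom_ext (by
    change Hom.hom f ≫ _ ≫ _ = _ ≫ _
    rw [← Category.assoc, f.comp_p])
  zero_comp P Q R f := hom_ext (by
    change (_ ≫ _) ≫ Hom.hom f = _ ≫ _
    rw [Category.assoc, f.s_comp])

variable [HasZeroMorphisms C] [SemiAbelian C]

/-- The kernel functor `Ker : Pt Z ⥤ C`, sending a point to the kernel of its split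
epimorphism. -/
def ker (Z : C) : Pt Z ⥤ C where
  obj P := kernel P.p
  map {P Q} f := kernel.lift Q.p (kernel.ι P.p ≫ Hom.hom f) (by simp [f.comp_p])
  map_id P := by ext; simp
  map_comp f g := by ext; simp

/-- The inclusion of the kernel of a point. -/
def kerι (P : Pt Z) : (ker Z).obj P ⟶ P.obj :=
  kernel.ι P.p

instance (P : Pt Z) : Mono (kerι P) :=
  inferInstanceAs (Mono (kernel.ι P.p))

theorem kerι_p (P : Pt Z) : kerι P ≫ P.p = 0 :=
  kernel.condition P.p

theorem ker_map_ι {P Q : Pt Z} (f : P ⟶ Q) :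
    (ker Z).map f ≫ kerι Q = kerι P ≫ Hom.hom f :=
  kernel.lift_ι _ _ _

instance : (ker Z).PreservesMonomorphisms where
  preserves {P Q} f hf := by
    refine ⟨fun {T} a b h => ?_⟩
    have h₁ : (coprod.inl : Z ⟶ Z ⨿ T) ≫ coprod.desc (𝟙 Z) 0 = 𝟙 Z := coprod.inl_desc _ _
    have h₂ (c : T ⟶ (ker Z).obj P) :
        coprod.desc P.s (c ≫ kerι P) ≫ P.p = coprod.desc (𝟙 Z) 0 := by
      rw [coprod.desc_comp, Category.assoc, kerι_p, P.section_eq, comp_zero]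
    let F (c : T ⟶ (ker Z).obj P) :
        (⟨Z ⨿ T, coprod.desc (𝟙 Z) 0, coprod.inl, h₁⟩ : Pt Z) ⟶ P :=
      ⟨coprod.desc P.s (c ≫ kerι P), h₂ c, coprod.inl_desc _ _⟩
    have key (c : T ⟶ (ker Z).obj P) : coprod.desc P.s (c ≫ kerι P) ≫ Hom.hom f
        = coprod.desc Q.s ((c ≫ (ker Z).map f) ≫ kerι Q) := by
      rw [Category.assoc, ker_map_ι, coprod.desc_comp, f.s_comp, Category.assoc]
    have e : F a = F b := (cancel_mono f).1 (hom_ext ((key a).trans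
      ((congrArg (fun t => coprod.desc Q.s (t ≫ kerι Q)) h).trans (key b).symm)))
    have e' : coprod.desc P.s (a ≫ kerι P) = coprod.desc P.s (b ≫ kerι P) :=
      congrArg Hom.hom e
    have e'' := congrArg (fun t => coprod.inr ≫ t) e'
    simp only [coprod.inr_desc] at e''
    exact (cancel_mono (kerι P)).1 e''

/-- The kernel functor on subobjects: a subobject of the point `Y` gives a subobject of
the kernel of `Y`. -/
def kerSubobject {Y : Pt Z} (N : Subobject Y) : Subobject ((ker Z).obj Y) :=
  Subobject.mk ((ker Z).map N.arrow)

end Pt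

end Points

end HuqHiggins

end

/-! Since `A ⨿ B ⟶ A ⨯ B` is a strong epimorphism, it is the cokernel of its kernel, the co-smash
product. Hence `K` and `L` commute modulo a normal `M` exactly when `[K, L] ≤ M`, so the Huq
commutator is the normal closure of the Higgins commutator. This closure exists because reflexive
relations are effective.

The Higgins commutator does not depend on the ambient object (`map_higginsCommutator`). Therefore
`[K, L]_X = [K, L]_Y` holds if and only if `[K, L]_X` is normal in `Y` (`map_huqCommutator_eq_iff`),
and (NH) gives all the equalities.

The decisive converse is `conditionNH_of_protosplit`. For normal `K` and `L` in `X`, the join `J = K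
⊔ L` is normal; let `R` be the kernel pair of a morphism with kernel `J`. The embedding `y ↦ (0, y)`
makes `J` the kernel of the first projection of `R`, split by the diagonal, and `K`, `L` stay normal
in `R`. Since they span `J`, their Huq commutator in `J` is the Higgins commutator. If it is normal
in `R`, its direct image along the second projection, which is `[K, L]` in `X`, is normal too.

Finally, the kernels of normal subobjects of a point `Y` are exactly the subobjects of its kernel
that are normal in `Y.obj`. This translates the protosplit conditions into conditions on points. -/

noncomputable section

namespace HuqHiggins

attribute [local simp] pullback.lift_fst pullback.lift_snd pullback.lift_fst_assoc
  pullback.lift_snd_assoc prod.lift_fst prod.lift_snd prod.lift_fst_assoc prod.lift_snd_assoc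
  coprod.inl_desc coprod.inr_desc coprod.inl_desc_assoc coprod.inr_desc_assoc

/-! ### Subobjects and factorization of generalized elements -/

section Subobjects

variable {C : Type u} [Category.{v} C]

theorem factors_arrow {X : C} (N : Subobject X) : N.Factors N.arrow :=
  (N.factors_iff _).2 ⟨𝟙 _, Category.id_comp _⟩

theorem mk_factors_iff {X A T : C} (m : A ⟶ X) [Mono m] (t : T ⟶ X) :
    (Subobject.mk m).Factors t ↔ ∃ u, u ≫ m = t :=
  Iff.rfl

theorem le_iff_factors {X : C} {M N : Subobject X} : M ≤ N ↔ N.Factors M.arrow :=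
  ⟨fun h => (N.factors_iff _).2 ⟨Subobject.ofLE M N h, Subobject.ofLE_arrow h⟩,
    fun h => Subobject.le_of_comm (N.factorThru _ h) (N.factorThru_arrow _ h)⟩

theorem map_factors_iff {X Y T : C} (x : X ⟶ Y) [Mono x] (M : Subobject X) (t : T ⟶ Y) :
    ((Subobject.map x).obj M).Factors t ↔ ∃ u, M.Factors u ∧ u ≫ x = t := by
  induction M using Subobject.ind with
  | _ m =>
    rw [Subobject.map_mk, mk_factors_iff]
    constructor
    · rintro ⟨u, rfl⟩
      exact ⟨u ≫ m, ⟨u, rfl⟩, Category.assoc _ _ _⟩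
    · rintro ⟨_, ⟨u, rfl⟩, rfl⟩
      exact ⟨u, (Category.assoc _ _ _).symm⟩

/-- The diagonal filler of `e` against `M.arrow`: membership in a subobject may be tested on a
cover. -/
theorem factors_of_strongEpi {X A B : C} (M : Subobject X) (e : A ⟶ B) [StrongEpi e]
    (t : B ⟶ X) (h : M.Factors (e ≫ t)) : M.Factors t := by
  have sq : CommSq (M.factorThru _ h) e M.arrow t := ⟨M.factorThru_arrow _ h⟩
  exact (M.factors_iff _).2 ⟨sq.lift, sq.fac_right⟩

theorem map_le_iff [HasPullbacks C] {X Y : C} (x : X ⟶ Y) [Mono x] (M : Subobject X)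
    (N : Subobject Y) :
    (Subobject.map x).obj M ≤ N ↔ M ≤ (Subobject.pullback x).obj N :=
  (Subobject.mapPullbackAdj x).gc.le_iff_le

theorem exists_le_iff [HasPullbacks C] [HasImages C] {X Y : C} (f : X ⟶ Y) (M : Subobject X)
    (N : Subobject Y) :
    (Subobject.exists f).obj M ≤ N ↔ M ≤ (Subobject.pullback f).obj N :=
  (Subobject.existsPullbackAdj f).gc.le_iff_le

theorem exists_factors [HasPullbacks C] [HasImages C] {X Y T : C} (f : X ⟶ Y)
    (M : Subobject X) (t : T ⟶ X) (h : M.Factors t) :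
    ((Subobject.exists f).obj M).Factors (t ≫ f) := by
  have := Subobject.factors_of_le t ((exists_le_iff f M _).1 le_rfl) h
  rwa [pullback_factors_iff] at this

theorem imageSubobject_le_iff [HasImages C] [HasEqualizers C] {X Y : C} (f : X ⟶ Y)
    (M : Subobject Y) : imageSubobject f ≤ M ↔ M.Factors f := by
  refine ⟨fun h => Subobject.factors_of_le f h ?_, fun h => ?_⟩
  · exact (Subobject.factors_iff _ _).2 ⟨factorThruImageSubobject f, imageSubobject_arrow_comp f⟩
  · exact imageSubobject_le f (M.factorThru f h) (M.factorThru_arrow f h)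

end Subobjects

/-! ### Kernels and normal subobjects -/

section ZeroMorphisms

variable {C : Type u} [Category.{v} C] [HasZeroMorphisms C]

theorem isKernelOf_iff {K A B : C} {k : K ⟶ A} {p : A ⟶ B} :
    IsKernelOf k p ↔ Mono k ∧ k ≫ p = 0 ∧
      ∀ {T : C} (t : T ⟶ A), t ≫ p = 0 → ∃ u, u ≫ k = t := by
  constructor
  · rintro ⟨w, ⟨h⟩⟩
    exact ⟨mono_of_isLimit_fork h, w, fun t ht => ⟨h.lift (KernelFork.ofι t ht),
      h.fac (KernelFork.ofι t ht) WalkingParallelPair.zero⟩⟩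
  · rintro ⟨hk, w, h⟩
    choose l hl using @h
    exact ⟨w, ⟨KernelFork.IsLimit.ofι k w (fun t ht => l t ht) (fun t ht => hl t ht)
      (fun t ht m hm => (cancel_mono k).1 (hm.trans (hl t ht).symm))⟩⟩

theorem isKernelOf_kernel {A B : C} (p : A ⟶ B) [HasKernel p] : IsKernelOf (kernel.ι p) p :=
  ⟨kernel.condition p, ⟨kernelIsKernel p⟩⟩

theorem factors_iff_of_isKernelOf {X D : C} {N : Subobject X} {g : X ⟶ D} :
    IsKernelOf N.arrow g ↔ ∀ {T : C} (t : T ⟶ X), N.Factors t ↔ t ≫ g = 0 := by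
  rw [isKernelOf_iff]
  constructor
  · rintro ⟨-, w, h⟩ T t
    refine ⟨fun ht => ?_, fun ht => ?_⟩
    · rw [← N.factorThru_arrow t ht, Category.assoc, w, comp_zero]
    · obtain ⟨u, rfl⟩ := h t ht
      exact N.factors_comp_arrow u
  · intro h
    exact ⟨inferInstance, (h _).1 (factors_arrow N),
      fun t ht => ⟨N.factorThru t ((h t).2 ht), N.factorThru_arrow _ _⟩⟩

theorem isNormalSubobject_iff {X : C} {N : Subobject X} :
    IsNormalSubobject N ↔ ∃ (D : C) (g : X ⟶ D), ∀ {T : C} (t : T ⟶ X),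
      N.Factors t ↔ t ≫ g = 0 := by
  simp only [IsNormalSubobject, IsNormalMono, factors_iff_of_isKernelOf]

theorem IsNormalSubobject.pullback_obj [HasPullbacks C] {X Y : C} (f : X ⟶ Y) {N : Subobject Y}
    (h : IsNormalSubobject N) : IsNormalSubobject ((Subobject.pullback f).obj N) := by
  rw [isNormalSubobject_iff] at h ⊢
  obtain ⟨D, g, hg⟩ := h
  exact ⟨D, f ≫ g, fun t => by rw [pullback_factors_iff, hg, Category.assoc]⟩

theorem IsNormalSubobject.of_map [HasPullbacks C] {X Y : C} (x : X ⟶ Y) [Mono x]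
    {N : Subobject X} (h : IsNormalSubobject ((Subobject.map x).obj N)) :
    IsNormalSubobject N := by
  have := h.pullback_obj x
  rwa [Subobject.pullback_map_self] at this

theorem IsKernelOf.exists_iso {A B K K' : C} {p : A ⟶ B} {k : K ⟶ A} {k' : K' ⟶ A}
    (hk : IsKernelOf k p) (hk' : IsKernelOf k' p) : ∃ e : K ⟶ K', IsIso e ∧ e ≫ k' = k := by
  obtain ⟨h₁, h₂, h₃⟩ := isKernelOf_iff.1 hk
  obtain ⟨h₁', h₂', h₃'⟩ := isKernelOf_iff.1 hk'
  obtain ⟨e, he⟩ := h₃' k h₂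
  obtain ⟨u, hu⟩ := h₃ k' h₂'
  exact ⟨e, ⟨u, by rw [← cancel_mono k, Category.assoc, hu, he, Category.id_comp],
    by rw [← cancel_mono k', Category.assoc, he, hu, Category.id_comp]⟩, he⟩

theorem IsProtosplitMono.isNormalMono {A B : C} {f : A ⟶ B}
    (h : IsProtosplitMono f) : IsNormalMono f :=
  let ⟨D, g, _, hg⟩ := h
  ⟨D, g, hg⟩

theorem isNormalSubobject_map_iso {X Y : C} (e : X ⟶ Y) [IsIso e] {N : Subobject X}
    (h : IsNormalSubobject N) : IsNormalSubobject ((Subobject.map e).obj N) := by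
  rw [isNormalSubobject_iff] at h ⊢
  obtain ⟨D, g, hg⟩ := h
  refine ⟨D, inv e ≫ g, fun t => ?_⟩
  rw [map_factors_iff, ← Category.assoc, ← hg]
  constructor
  · rintro ⟨u, hu, rfl⟩
    simpa using hu
  · intro h
    exact ⟨t ≫ inv e, h, by simp⟩

end ZeroMorphisms

/-! ### Consequences of protomodularity and exactness -/

section SemiAbelian

variable {C : Type u} [Category.{v} C] [HasZeroMorphisms C] [SemiAbelian C]

/-- The kernel and the section of a split epimorphism are jointly extremal-epic. -/
theorem isIso_of_kernel_section {K A B M : C} {k : K ⟶ A} {p : A ⟶ B} {s : B ⟶ A}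
    (hk : IsKernelOf k p) (hs : s ≫ p = 𝟙 B) (m : M ⟶ A) [Mono m] (a : K ⟶ M) (ha : a ≫ m = k)
    (b : B ⟶ M) (hb : b ≫ m = s) : IsIso m := by
  have hk' := hk
  rw [isKernelOf_iff] at hk'
  obtain ⟨hk₁, hk₂, hk₃⟩ := hk'
  -- Both `M` and `A` are split extensions of `B` by `K`, so the split short five lemma applies to
  -- `m`.
  have : IsKernelOf a (m ≫ p) := by
    rw [isKernelOf_iff]
    refine ⟨mono_of_mono_fac ha, by rw [← Category.assoc, ha, hk₂], fun t ht => ?_⟩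
    obtain ⟨u, hu⟩ := hk₃ (t ≫ m) (by rw [Category.assoc, ht])
    exact ⟨u, by rw [← cancel_mono m, Category.assoc, ha, hu]⟩
  exact SemiAbelian.split_short_five a (m ≫ p) b k p s (𝟙 _) m (𝟙 _) this
    (by rw [← Category.assoc, hb, hs]) hk hs (by simp [ha]) (by simp) (by simp [hb])
    inferInstance inferInstance

/-- The pullback of `M` along `h` contains both the kernel and the section, hence is all of `A`.
This replaces element-wise subtraction in the arguments below. -/
theorem factors_of_kernel_section {K A B Y : C} {k : K ⟶ A} {p : A ⟶ B} {s : B ⟶ A}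
    (hk : IsKernelOf k p) (hs : s ≫ p = 𝟙 B) (M : Subobject Y) (h : A ⟶ Y)
    (h₁ : M.Factors (k ≫ h)) (h₂ : M.Factors (s ≫ h)) : M.Factors h := by
  have := isIso_of_kernel_section hk hs (pullback.fst h M.arrow)
    (pullback.lift k (M.factorThru _ h₁) (by simp)) (by simp)
    (pullback.lift s (M.factorThru _ h₂) (by simp)) (by simp)
  rw [Subobject.factors_iff]
  refine ⟨inv (pullback.fst h M.arrow) ≫ pullback.snd h M.arrow, ?_⟩
  change (_ ≫ _) ≫ M.arrow = h
  rw [Category.assoc, ← pullback.condition, IsIso.inv_hom_id_assoc]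

theorem hom_ext_kernel_section {K A B Y : C} {k : K ⟶ A} {p : A ⟶ B} {s : B ⟶ A}
    (hk : IsKernelOf k p) (hs : s ≫ p = 𝟙 B) {f g : A ⟶ Y}
    (h₁ : k ≫ f = k ≫ g) (h₂ : s ≫ f = s ≫ g) : f = g := by
  have := isIso_of_kernel_section hk hs (equalizer.ι f g) (equalizer.lift k h₁) (by simp)
    (equalizer.lift s h₂) (by simp)
  rw [← cancel_epi (equalizer.ι f g), equalizer.condition]

/-- Every relation in a semi-abelian category is difunctional. -/
theorem difunctional {R X Y T : C} (d : R ⟶ X) (c : R ⟶ Y) [Mono (prod.lift d c)]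
    (a b e : T ⟶ R) (hab : a ≫ c = b ≫ c) (hbe : b ≫ d = e ≫ d) :
    ∃ w : T ⟶ R, w ≫ d = a ≫ d ∧ w ≫ c = e ≫ c := by
  -- The domain of `p` consists of triples `(a, b, e)` as in the statement; `p` forgets `e` and is
  -- split by `(a, b) ↦ (a, b, b)`. On the kernel of `p` the required element is `e`, on the section
  -- it is `a`.
  let p := pullback.fst (pullback.snd c c) (pullback.fst d d)
  let r := pullback.snd (pullback.snd c c) (pullback.fst d d)
  have hpr : p ≫ pullback.snd c c = r ≫ pullback.fst d d := pullback.condition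
  let s : pullback c c ⟶ pullback (pullback.snd c c) (pullback.fst d d) :=
    pullback.lift (𝟙 _) (pullback.snd c c ≫ pullback.lift (𝟙 _) (𝟙 _) rfl) (by simp)
  have hs : s ≫ p = 𝟙 _ := by simp [s, p]
  have hsr : s ≫ r = pullback.snd c c ≫ pullback.lift (𝟙 _) (𝟙 _) rfl := by simp [s, r]
  have key := factors_of_kernel_section (isKernelOf_kernel p) hs
    (Subobject.mk (prod.lift d c))
    (prod.lift (p ≫ pullback.fst c c ≫ d) (r ≫ pullback.snd d d ≫ c)) ?_ ?_
  · rw [mk_factors_iff] at key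
    obtain ⟨u, hu⟩ := key
    let t : T ⟶ pullback (pullback.snd c c) (pullback.fst d d) :=
      pullback.lift (pullback.lift a b hab) (pullback.lift b e hbe) (by simp)
    have h₁ : u ≫ d = p ≫ pullback.fst c c ≫ d := by simpa using congrArg (· ≫ prod.fst) hu
    have h₂ : u ≫ c = r ≫ pullback.snd d d ≫ c := by simpa using congrArg (· ≫ prod.snd) hu
    refine ⟨t ≫ u, ?_, ?_⟩
    · rw [Category.assoc, h₁]
      simp [t, p]
    · rw [Category.assoc, h₂]
      simp [t, r]
  · rw [mk_factors_iff]
    refine ⟨kernel.ι p ≫ r ≫ pullback.snd d d, ?_⟩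
    ext
    · have : kernel.ι p ≫ r ≫ pullback.snd d d ≫ d = 0 := by
        rw [← pullback.condition, ← reassoc_of% hpr, kernel.condition_assoc, zero_comp]
      simp [this]
    · simp
  · rw [mk_factors_iff]
    refine ⟨pullback.fst c c, ?_⟩
    ext
    · simp [reassoc_of% hs]
    · simp [reassoc_of% hsr, pullback.condition]

/-- Every reflexive relation in a semi-abelian category is a kernel pair. -/
theorem exists_isKernelPair {R X : C} (m : R ⟶ X ⨯ X) [Mono m]
    (h : ∃ r, r ≫ m = prod.lift (𝟙 X) (𝟙 X)) :
    ∃ (Y : C) (f : X ⟶ Y), IsKernelPair f (m ≫ prod.fst) (m ≫ prod.snd) := by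
  obtain ⟨r, hr⟩ := h
  have hm : prod.lift (m ≫ prod.fst) (m ≫ prod.snd) = m := by ext <;> simp
  have : Mono (prod.lift (m ≫ prod.fst) (m ≫ prod.snd)) := hm.symm ▸ inferInstance
  have r₁ : r ≫ m ≫ prod.fst = 𝟙 X := by rw [← Category.assoc, hr, prod.lift_fst]
  have r₂ : r ≫ m ≫ prod.snd = 𝟙 X := by rw [← Category.assoc, hr, prod.lift_snd]
  -- Symmetry: from `(y, y)`, `(x, y)`, `(x, x)` difunctionality produces `(y, x)`.
  obtain ⟨σ, hσ₁, hσ₂⟩ := difunctional (m ≫ prod.fst) (m ≫ prod.snd)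
    ((m ≫ prod.snd) ≫ r) (𝟙 R) ((m ≫ prod.fst) ≫ r) (by simp [r₂]) (by simp [r₁])
  -- Transitivity: from `(x, y)`, `(y, y)`, `(y, z)` it produces `(x, z)`.
  obtain ⟨τ, hτ₁, hτ₂⟩ := difunctional (m ≫ prod.fst) (m ≫ prod.snd)
    (pullback.fst (m ≫ prod.snd) (m ≫ prod.fst))
    (pullback.fst (m ≫ prod.snd) (m ≫ prod.fst) ≫ (m ≫ prod.snd) ≫ r)
    (pullback.snd (m ≫ prod.snd) (m ≫ prod.fst)) (by simp [r₂])
    (by rw [Category.assoc, Category.assoc, r₁, Category.comp_id, pullback.condition])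
  have e : EquivalenceRelation (m ≫ prod.fst) (m ≫ prod.snd) :=
    { right_cancellation := fun T f g h₁ h₂ => by
        rw [← cancel_mono m]
        ext <;> simpa
      r := r
      reflexivity₁ := r₁
      reflexivity₂ := r₂
      s := σ
      symmetry₁ := by rw [hσ₁, Category.assoc, r₁, Category.comp_id]
      symmetry₂ := by rw [hσ₂, Category.assoc, r₂, Category.comp_id]
      c := PullbackCone.mk _ _ pullback.condition
      isLimit := pullbackIsPullback _ _
      t := τ
      transitivity₁ := hτ₁
      transitivity₂ := hτ₂ }
  exact SemiAbelian.effective _ _ e.isEquivalenceRelation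

/-- A strong epimorphism is the cokernel of its kernel. -/
theorem isCokernelOf_of_strongEpi {K X Q : C} {k : K ⟶ X} {q : X ⟶ Q} [StrongEpi q]
    (hk : IsKernelOf k q) : IsCokernelOf q k := by
  have hk' := isKernelOf_iff.1 hk
  obtain ⟨-, w, hl⟩ := hk'
  obtain ⟨⟨W, l, r, hw, hc⟩⟩ := (inferInstance : IsRegularEpi q)
  have key {D : C} (g : X ⟶ D) (hg : k ≫ g = 0) : l ≫ g = r ≫ g := by
    -- The two sides agree on the diagonal, and on the kernel of the first projection both vanish
    -- because `g` kills the kernel of `q`.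
    have hfs : pullback.fst q q ≫ g = pullback.snd q q ≫ g := by
      refine hom_ext_kernel_section (isKernelOf_kernel (pullback.fst q q))
        (s := pullback.lift (𝟙 _) (𝟙 _) rfl) (by simp) ?_ (by simp)
      obtain ⟨u, hu⟩ := hl (kernel.ι (pullback.fst q q) ≫ pullback.snd q q)
        (by rw [Category.assoc, ← pullback.condition, kernel.condition_assoc, zero_comp])
      rw [kernel.condition_assoc, zero_comp, ← Category.assoc, ← hu, Category.assoc, hg, comp_zero]
    have := congrArg (pullback.lift l r hw ≫ ·) hfs
    simpa using this
  refine ⟨w, ⟨CokernelCofork.IsColimit.ofπ q w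
    (fun g hg => hc.desc (Cofork.ofπ g (key g hg)))
    (fun g hg => hc.fac (Cofork.ofπ g (key g hg)) WalkingParallelPair.one)
    (fun g hg m hm => ?_)⟩⟩
  rw [← cancel_epi q, hm]
  exact (hc.fac (Cofork.ofπ g (key g hg)) WalkingParallelPair.one).symm

theorem exists_strongEpi_mono {X Y : C} (f : X ⟶ Y) :
    ∃ (I : C) (e : X ⟶ I) (m : I ⟶ Y), IsRegularEpi e ∧ Mono m ∧ e ≫ m = f :=
  ⟨_, (Regular.strongEpiMonoFactorisation f).e, (Regular.strongEpiMonoFactorisation f).m,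
    inferInstance, inferInstance, (Regular.strongEpiMonoFactorisation f).fac⟩

theorem IsNormalSubobject.exists_quotient {X : C} {N : Subobject X} (h : IsNormalSubobject N) :
    ∃ (Q : C) (q : X ⟶ Q), StrongEpi q ∧ IsCokernelOf q N.arrow ∧
      ∀ {T : C} (t : T ⟶ X), N.Factors t ↔ t ≫ q = 0 := by
  obtain ⟨D, g, hg⟩ := isNormalSubobject_iff.1 h
  obtain ⟨I, e, m, he, hm, rfl⟩ := exists_strongEpi_mono g
  have he' : ∀ {T : C} (t : T ⟶ X), N.Factors t ↔ t ≫ e = 0 := fun t => by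
    rw [hg, ← Category.assoc, ← cancel_mono m, zero_comp]
  have hs : StrongEpi e := inferInstance
  exact ⟨I, e, hs, isCokernelOf_of_strongEpi (factors_iff_of_isKernelOf.2 he'), he'⟩

/-- The relation generated by the pairs `(h, 0)` and the diagonal is reflexive, hence the kernel
pair of some `f`, and the closure is the kernel of `f`. Any `g` killing `H` equalizes the
generators, hence the whole relation, which contains `(n, 0)` for `n` in the kernel of `f`. -/
theorem exists_normalClosure {X : C} (H : Subobject X) :
    ∃ N : Subobject X, IsNormalSubobject N ∧ H ≤ N ∧
      ∀ M : Subobject X, IsNormalSubobject M → H ≤ M → N ≤ M := by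
  obtain ⟨I, e, m, he, hm, hem⟩ :=
    exists_strongEpi_mono (coprod.desc (prod.lift H.arrow 0) (prod.lift (𝟙 X) (𝟙 X)))
  obtain ⟨Y, f, hf⟩ := exists_isKernelPair m ⟨coprod.inr ≫ e, by simp [hem]⟩
  refine ⟨kernelSubobject f, ?_, ?_, fun M hM hHM => ?_⟩
  · exact isNormalSubobject_iff.2 ⟨Y, f, fun t => kernelSubobject_factors_iff f t⟩
  · refine le_kernelSubobject _ _ ?_
    have := congrArg (fun t => (coprod.inl ≫ e) ≫ t) hf.w
    simpa [reassoc_of% hem] using this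
  · obtain ⟨D, g, hg⟩ := isNormalSubobject_iff.1 hM
    have hHg : H.arrow ≫ g = 0 := (hg _).1 (le_iff_factors.1 hHM)
    have hmg : m ≫ prod.fst ≫ g = m ≫ prod.snd ≫ g := by
      rw [← cancel_epi e, reassoc_of% hem, reassoc_of% hem]
      ext <;> simp [hHg]
    rw [le_iff_factors, hg]
    obtain ⟨u, hu₁, hu₂⟩ := hf.exists_lift (kernelSubobject f).arrow 0 (by simp)
    rw [← hu₁, Category.assoc, Category.assoc, hmg, ← Category.assoc, ← Category.assoc,
      Category.assoc u, hu₂, zero_comp]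

/-- The direct image of a normal subobject along a strong epimorphism is normal. -/
theorem IsNormalSubobject.exists_obj {X Y : C} (f : X ⟶ Y) [StrongEpi f] {N : Subobject X}
    (h : IsNormalSubobject N) : IsNormalSubobject ((Subobject.exists f).obj N) := by
  obtain ⟨Q, q, hq⟩ := isNormalSubobject_iff.1 h
  -- `S` is the image under `f × f` of the kernel pair of `q`; it is reflexive because `f` is a
  -- strong epimorphism.
  obtain ⟨S, e, m, he, hm, hem⟩ := exists_strongEpi_mono
    (prod.lift (pullback.fst q q ≫ f) (pullback.snd q q ≫ f))
  have hem₁ : e ≫ m ≫ prod.fst = pullback.fst q q ≫ f := by rw [reassoc_of% hem, prod.lift_fst]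
  have hem₂ : e ≫ m ≫ prod.snd = pullback.snd q q ≫ f := by rw [reassoc_of% hem, prod.lift_snd]
  obtain ⟨D, g, hg⟩ := exists_isKernelPair m (by
    rw [← mk_factors_iff]
    refine factors_of_strongEpi _ f _ ⟨pullback.lift (𝟙 _) (𝟙 _) rfl ≫ e, ?_⟩
    change (_ ≫ e) ≫ m = _
    rw [Category.assoc, hem]
    ext <;> simp)
  rw [isNormalSubobject_iff]
  refine ⟨D, g, fun {T} t => ⟨fun ht => ?_, fun ht => ?_⟩⟩
  · rw [← kernelSubobject_factors_iff]
    refine Subobject.factors_of_le t ?_ ht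
    rw [exists_le_iff, le_iff_factors, pullback_factors_iff, kernelSubobject_factors_iff]
    have hN : N.arrow ≫ q = 0 := (hq _).1 (factors_arrow _)
    have := congrArg (fun t => (pullback.lift 0 N.arrow (by simp [hN]) ≫ e) ≫ t) hg.w
    simp only [Category.assoc, reassoc_of% hem₁, reassoc_of% hem₂] at this
    simpa using this.symm
  -- If `(x, y)` is in the kernel pair of `q` and `f x = 0`, then `f y` lies in the image of `N`.
  -- Such pairs project to `kernel f`, split by the diagonal: on the kernel `y` lies in `N`, on the
  -- section `f y = f x = 0`.
  · have key {U : C} (a : U ⟶ pullback q q) (ha : a ≫ pullback.fst q q ≫ f = 0) :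
        ((Subobject.exists f).obj N).Factors (a ≫ pullback.snd q q ≫ f) := by
      let R := pullback (pullback.fst q q) (kernel.ι f)
      let p : R ⟶ pullback q q := pullback.fst _ _
      let r : R ⟶ kernel f := pullback.snd _ _
      have hpr : p ≫ pullback.fst q q = r ≫ kernel.ι f := pullback.condition
      have h₀ : ((Subobject.exists f).obj N).Factors (p ≫ pullback.snd q q ≫ f) := by
        refine factors_of_kernel_section (isKernelOf_kernel r)
          (s := pullback.lift (kernel.ι f ≫ pullback.lift (𝟙 _) (𝟙 _) rfl) (𝟙 _) (by simp))
          (by simp [r]) _ _ ?_ ?_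
        · rw [← Category.assoc, ← Category.assoc]
          refine exists_factors f N _ ((hq _).2 ?_)
          rw [Category.assoc, Category.assoc, ← pullback.condition, reassoc_of% hpr,
            kernel.condition_assoc, zero_comp]
        · simpa [p] using Subobject.factors_zero
      have := Subobject.factors_of_factors_right
        (pullback.lift a (kernel.lift f (a ≫ pullback.fst q q) (by simpa using ha)) (by simp)) h₀
      simpa [p] using this
    obtain ⟨u, hu₁, hu₂⟩ := hg.exists_lift 0 t (by simp [ht])
    -- The pair `(0, t)` lies in `S` but lifts to the kernel pair of `q` only after passing to a
    -- cover.
    refine factors_of_strongEpi _ (pullback.snd e u) _ ?_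
    have hc : pullback.fst e u ≫ e = pullback.snd e u ≫ u := pullback.condition
    have := key (pullback.fst e u) (by
      rw [← hem₁, reassoc_of% hc, hu₁, comp_zero])
    rwa [← hem₂, reassoc_of% hc, hu₂] at this

/-- The join is the saturation of `L` under congruence modulo `K`: pull `L` back along one
projection of the kernel pair and take the image along the other, a split epimorphism. -/
theorem IsNormalSubobject.sup {X : C} {K L : Subobject X} (hK : IsNormalSubobject K)
    (hL : IsNormalSubobject L) : IsNormalSubobject (K ⊔ L) := by
  obtain ⟨Q, q, hq⟩ := isNormalSubobject_iff.1 hK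
  have hs : IsSplitEpi (pullback.snd q q) :=
    ⟨⟨⟨pullback.lift (𝟙 _) (𝟙 _) rfl, pullback.lift_snd _ _ _⟩⟩⟩
  have hKq : K.arrow ≫ q = 0 := (hq _).1 (factors_arrow _)
  suffices K ⊔ L = (Subobject.exists (pullback.snd q q)).obj
      ((Subobject.pullback (pullback.fst q q)).obj L) by
    rw [this]
    exact (hL.pullback_obj _).exists_obj _
  refine le_antisymm (sup_le ?_ ?_) ?_
  · rw [le_iff_factors]
    have := exists_factors (pullback.snd q q) ((Subobject.pullback (pullback.fst q q)).obj L)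
      (pullback.lift 0 K.arrow (by simp [hKq]))
      (by rw [pullback_factors_iff, pullback.lift_fst]; exact Subobject.factors_zero)
    rwa [pullback.lift_snd] at this
  · rw [le_iff_factors]
    have := exists_factors (pullback.snd q q) ((Subobject.pullback (pullback.fst q q)).obj L)
      (pullback.lift L.arrow L.arrow rfl)
      (by rw [pullback_factors_iff, pullback.lift_fst]; exact factors_arrow _)
    rwa [pullback.lift_snd] at this
  · rw [exists_le_iff, le_iff_factors, pullback_factors_iff]
    have hc := (Subobject.isPullback (pullback.fst q q) L).w
    obtain ⟨s, hs₁, hs₂⟩ := (Subobject.isPullback (pullback.fst q q) L).exists_lift (𝟙 _)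
      (pullback.lift L.arrow L.arrow rfl) (by simp)
    -- Pairs `(l, y)` with `l` in `L` project to `L`, split by the diagonal: on the kernel `y` lies
    -- in `K`, on the section in `L`.
    refine factors_of_kernel_section (isKernelOf_kernel
      (Subobject.pullbackπ (pullback.fst q q) L)) hs₁ _ _ ?_ ?_
    · refine Subobject.sup_factors_of_factors_left ((hq _).2 ?_)
      rw [Category.assoc, Category.assoc, ← pullback.condition, ← reassoc_of% hc,
        kernel.condition_assoc, zero_comp]
    · refine Subobject.sup_factors_of_factors_right ?_
      rw [← Category.assoc, hs₂, pullback.lift_snd]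
      exact factors_arrow _

end SemiAbelian

/-! ### Huq and Higgins commutators -/

section Commutators

variable {C : Type u} [Category.{v} C] [HasZeroMorphisms C] [SemiAbelian C]

theorem inl_coprodToProd (A B : C) : coprod.inl ≫ coprodToProd A B = prod.lift (𝟙 A) 0 :=
  coprod.inl_desc _ _

theorem inr_coprodToProd (A B : C) : coprod.inr ≫ coprodToProd A B = prod.lift 0 (𝟙 B) :=
  coprod.inr_desc _ _

/-- The first projection of `A ⨯ B` has kernel `B` and section `A`, and the image of the comparison
contains both. -/
instance strongEpi_coprodToProd (A B : C) : StrongEpi (coprodToProd A B) := by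
  obtain ⟨I, e, m, he, hm, hem⟩ := exists_strongEpi_mono (coprodToProd A B)
  have hk : IsKernelOf (prod.lift (0 : B ⟶ A) (𝟙 B)) (prod.fst : A ⨯ B ⟶ A) := by
    rw [isKernelOf_iff]
    refine ⟨inferInstance, by simp, fun t ht => ⟨t ≫ prod.snd, ?_⟩⟩
    ext <;> simp [ht]
  have := isIso_of_kernel_section hk (s := prod.lift (𝟙 A) 0) (by simp) m
    (coprod.inr ≫ e) (by rw [Category.assoc, hem, inr_coprodToProd])
    (coprod.inl ≫ e) (by rw [Category.assoc, hem, inl_coprodToProd])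
  rw [← hem]
  exact strongEpi_comp _ _

/-- Two morphisms commute if and only if the induced morphism on their coproduct vanishes on
the co-smash product. -/
theorem cooperate_iff {A B D : C} (f : A ⟶ D) (g : B ⟶ D) :
    Cooperate f g ↔ kernel.ι (coprodToProd A B) ≫ coprod.desc f g = 0 := by
  constructor
  · rintro ⟨φ, rfl, rfl⟩
    have : coprod.desc (prod.lift (𝟙 A) 0 ≫ φ) (prod.lift 0 (𝟙 B) ≫ φ) =
        coprodToProd A B ≫ φ := by
      ext
      · simp [reassoc_of% inl_coprodToProd]
      · simp [reassoc_of% inr_coprodToProd]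
    rw [this, kernel.condition_assoc, zero_comp]
  · intro h
    obtain ⟨w, ⟨hc⟩⟩ := isCokernelOf_of_strongEpi (isKernelOf_kernel (coprodToProd A B))
    have hφ : coprodToProd A B ≫ hc.desc (CokernelCofork.ofπ _ h) = coprod.desc f g :=
      hc.fac (CokernelCofork.ofπ _ h) WalkingParallelPair.one
    refine ⟨hc.desc (CokernelCofork.ofπ _ h), ?_, ?_⟩
    · rw [← inl_coprodToProd, Category.assoc, hφ, coprod.inl_desc]
    · rw [← inr_coprodToProd, Category.assoc, hφ, coprod.inr_desc]

theorem higginsCommutator_le_iff {X : C} (K L M : Subobject X) :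
    higginsCommutator K L ≤ M ↔
      M.Factors (kernel.ι (coprodToProd (K : C) (L : C)) ≫ coprod.desc K.arrow L.arrow) :=
  imageSubobject_le_iff _ _

theorem cooperateModulo_iff {X : C} (K L : Subobject X) {M : Subobject X}
    (hM : IsNormalSubobject M) : CooperateModulo K L M ↔ higginsCommutator K L ≤ M := by
  rw [higginsCommutator_le_iff]
  obtain ⟨Q, q, -, hc, hq⟩ := hM.exists_quotient
  constructor
  · rintro ⟨Q', q', ⟨w, ⟨hc'⟩⟩, h⟩
    rw [cooperate_iff, ← coprod.desc_comp] at h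
    have hqq : q' ≫ hc'.desc (CokernelCofork.ofπ q hc.1) = q :=
      hc'.fac (CokernelCofork.ofπ q hc.1) WalkingParallelPair.one
    rw [hq, ← hqq, ← Category.assoc, Category.assoc (kernel.ι _), h, zero_comp]
  · intro h
    refine ⟨Q, q, hc, ?_⟩
    rwa [cooperate_iff, ← coprod.desc_comp, ← Category.assoc, ← hq]

theorem isHuqCommutator_iff {X : C} (K L N : Subobject X) :
    IsHuqCommutator K L N ↔
      IsLeast {M : Subobject X | IsNormalSubobject M ∧ higginsCommutator K L ≤ M} N := by
  have : {M : Subobject X | IsNormalSubobject M ∧ CooperateModulo K L M} =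
      {M : Subobject X | IsNormalSubobject M ∧ higginsCommutator K L ≤ M} := by
    ext M
    exact and_congr_right fun hM => cooperateModulo_iff K L hM
  rw [IsHuqCommutator, this]

theorem isHuqCommutator_huqCommutator {X : C} (K L : Subobject X) :
    IsHuqCommutator K L (huqCommutator K L) := by
  have h : ∃ N, IsHuqCommutator K L N := by
    obtain ⟨N, hN, hle, hmin⟩ := exists_normalClosure (higginsCommutator K L)
    exact ⟨N, (isHuqCommutator_iff K L N).2 ⟨⟨hN, hle⟩, fun M hM => hmin M hM.1 hM.2⟩⟩
  rw [huqCommutator, dif_pos h]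
  exact h.choose_spec

theorem isNormalSubobject_huqCommutator {X : C} (K L : Subobject X) :
    IsNormalSubobject (huqCommutator K L) :=
  (isHuqCommutator_huqCommutator K L).1.1

theorem higginsCommutator_le_huqCommutator {X : C} (K L : Subobject X) :
    higginsCommutator K L ≤ huqCommutator K L :=
  ((isHuqCommutator_iff K L _).1 (isHuqCommutator_huqCommutator K L)).1.2

theorem huqCommutator_le {X : C} {K L M : Subobject X} (hM : IsNormalSubobject M)
    (h : higginsCommutator K L ≤ M) : huqCommutator K L ≤ M :=
  ((isHuqCommutator_iff K L _).1 (isHuqCommutator_huqCommutator K L)).2 ⟨hM, h⟩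

theorem huqCommutator_eq_higginsCommutator {X : C} {K L : Subobject X}
    (h : IsNormalSubobject (higginsCommutator K L)) :
    huqCommutator K L = higginsCommutator K L :=
  le_antisymm (huqCommutator_le h le_rfl) (higginsCommutator_le_huqCommutator K L)

theorem factors_cosmash_of_comp {X A A' B B' : C} (M : Subobject X) (a : A ⟶ A') (b : B ⟶ B')
    (k : A' ⟶ X) (l : B' ⟶ X)
    (h : M.Factors (kernel.ι (coprodToProd A' B') ≫ coprod.desc k l)) :
    M.Factors (kernel.ι (coprodToProd A B) ≫ coprod.desc (a ≫ k) (b ≫ l)) := by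
  have hab : coprod.map a b ≫ coprodToProd A' B' = coprodToProd A B ≫ prod.map a b := by
    ext <;> simp [reassoc_of% inl_coprodToProd, reassoc_of% inr_coprodToProd, inl_coprodToProd,
      inr_coprodToProd]
  have : kernel.ι (coprodToProd A B) ≫ coprod.desc (a ≫ k) (b ≫ l) =
      kernel.lift (coprodToProd A' B') (kernel.ι (coprodToProd A B) ≫ coprod.map a b)
        (by rw [Category.assoc, hab, kernel.condition_assoc, zero_comp]) ≫
        kernel.ι (coprodToProd A' B') ≫ coprod.desc k l := by
    simp
  rw [this]
  exact Subobject.factors_of_factors_right _ h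

/-- `K` and its image in `Y` have isomorphic underlying objects, likewise `L`, so functoriality of
the co-smash product compares the two commutators in both directions. -/
theorem map_higginsCommutator {X Y : C} (x : X ⟶ Y) [Mono x] (K L : Subobject X) :
    (Subobject.map x).obj (higginsCommutator K L) =
      higginsCommutator ((Subobject.map x).obj K) ((Subobject.map x).obj L) := by
  have hle (N : Subobject X) : ∃ a, a ≫ ((Subobject.map x).obj N).arrow = N.arrow ≫ x :=
    ⟨_, Subobject.factorThru_arrow _ _
      ((map_factors_iff x N _).2 ⟨N.arrow, factors_arrow N, rfl⟩)⟩
  have hge (N : Subobject X) : ∃ a, a ≫ N.arrow ≫ x = ((Subobject.map x).obj N).arrow := by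
    obtain ⟨u, hu, hux⟩ := (map_factors_iff x N _).1 (factors_arrow ((Subobject.map x).obj N))
    exact ⟨N.factorThru u hu, by rw [← Category.assoc, N.factorThru_arrow, hux]⟩
  refine eq_of_forall_ge_iff fun M => ?_
  rw [map_le_iff, higginsCommutator_le_iff, higginsCommutator_le_iff, pullback_factors_iff,
    Category.assoc, coprod.desc_comp]
  constructor
  · intro h
    obtain ⟨a, ha⟩ := hge K
    obtain ⟨b, hb⟩ := hge L
    rw [← ha, ← hb]
    exact factors_cosmash_of_comp M a b _ _ h
  · intro h
    obtain ⟨a, ha⟩ := hle K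
    obtain ⟨b, hb⟩ := hle L
    rw [← ha, ← hb]
    exact factors_cosmash_of_comp M a b _ _ h

/-- Huq commutators in `X` and in `Y` agree exactly when the first one is normal in `Y`. -/
theorem map_huqCommutator_eq_iff {X Y : C} (x : X ⟶ Y) [Mono x] (K L : Subobject X) :
    (Subobject.map x).obj (huqCommutator K L) =
        huqCommutator ((Subobject.map x).obj K) ((Subobject.map x).obj L) ↔
      IsNormalSubobject ((Subobject.map x).obj (huqCommutator K L)) := by
  refine ⟨fun h => h ▸ isNormalSubobject_huqCommutator _ _, fun h => le_antisymm ?_ ?_⟩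
  · rw [map_le_iff]
    refine huqCommutator_le ((isNormalSubobject_huqCommutator _ _).pullback_obj x) ?_
    rw [← map_le_iff, map_higginsCommutator]
    exact higginsCommutator_le_huqCommutator _ _
  · refine huqCommutator_le h ?_
    rw [← map_higginsCommutator]
    exact (Subobject.map x).monotone (higginsCommutator_le_huqCommutator K L)

/-- When `K` and `L` span `X`, the morphism `K + L ⟶ X` is a strong epimorphism, and the commutator
is the direct image along it of a kernel. -/
theorem isNormalSubobject_higginsCommutator_of_sup_eq_top {X : C} {K L : Subobject X}
    (h : K ⊔ L = ⊤) : IsNormalSubobject (higginsCommutator K L) := by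
  have : StrongEpi (coprod.desc K.arrow L.arrow) := by
    obtain ⟨I, e, m, he, hm, hem⟩ := exists_strongEpi_mono (coprod.desc K.arrow L.arrow)
    have : IsIso m := by
      rw [Subobject.isIso_iff_mk_eq_top, ← top_le_iff, ← h, sup_le_iff]
      constructor
      · exact Subobject.le_mk_of_comm (coprod.inl ≫ e) (by simp [hem])
      · exact Subobject.le_mk_of_comm (coprod.inr ≫ e) (by simp [hem])
    rw [← hem]
    exact strongEpi_comp _ _
  have hN : IsNormalSubobject (kernelSubobject (coprodToProd (K : C) (L : C))) :=
    isNormalSubobject_iff.2 ⟨_, _, fun t => kernelSubobject_factors_iff _ t⟩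
  have heq : (Subobject.exists (coprod.desc K.arrow L.arrow)).obj
      (kernelSubobject (coprodToProd (K : C) (L : C))) = higginsCommutator K L := by
    refine eq_of_forall_ge_iff fun M => ?_
    rw [exists_le_iff, le_iff_factors, pullback_factors_iff, higginsCommutator_le_iff]
    constructor
    · intro hM
      rw [← kernelSubobject_arrow' (coprodToProd (K : C) (L : C)), Category.assoc]
      exact Subobject.factors_of_factors_right _ hM
    · intro hM
      rw [← kernelSubobject_arrow (coprodToProd (K : C) (L : C)), Category.assoc]
      exact Subobject.factors_of_factors_right _ hM
  exact heq ▸ hN.exists_obj _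

/-- It suffices for normality of Higgins commutators that Huq commutators of subobjects which
span a protosplit normal subobject are normal in the ambient object. -/
theorem conditionNH_of_protosplit
    (H : ∀ (X Y : C) (x : X ⟶ Y) [Mono x] (K L : Subobject X), IsProtosplitMono x →
      IsNormalSubobject ((Subobject.map x).obj K) →
      IsNormalSubobject ((Subobject.map x).obj L) → K ⊔ L = ⊤ →
      IsNormalSubobject ((Subobject.map x).obj (huqCommutator K L))) :
    ConditionNH C := by
  intro X K L hK hL
  obtain ⟨Q, q, hq⟩ := isNormalSubobject_iff.1 (hK.sup hL)
  have hJ : (K ⊔ L).arrow ≫ q = 0 := (hq _).1 (factors_arrow _)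
  let j : ((K ⊔ L : Subobject X) : C) ⟶ pullback q q :=
    pullback.lift 0 (K ⊔ L).arrow (by simp [hJ])
  have hj₁ : j ≫ pullback.fst q q = 0 := pullback.lift_fst _ _ _
  have hj₂ : j ≫ pullback.snd q q = (K ⊔ L).arrow := pullback.lift_snd _ _ _
  have hj : Mono j := mono_of_mono_fac hj₂
  have hker {T : C} (t : T ⟶ pullback q q) (ht : t ≫ pullback.fst q q = 0) :
      ∃ u, u ≫ j = t ∧ u ≫ (K ⊔ L).arrow = t ≫ pullback.snd q q := by
    have h : (K ⊔ L).Factors (t ≫ pullback.snd q q) := by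
      rw [hq, Category.assoc, ← pullback.condition, reassoc_of% ht, zero_comp]
    refine ⟨(K ⊔ L).factorThru _ h, ?_, (K ⊔ L).factorThru_arrow _ h⟩
    ext
    · rw [Category.assoc, hj₁, comp_zero, ht]
    · rw [Category.assoc, hj₂, (K ⊔ L).factorThru_arrow _ h]
  have hsplit₁ : IsSplitEpi (pullback.fst q q) :=
    ⟨⟨⟨pullback.lift (𝟙 _) (𝟙 _) rfl, pullback.lift_fst _ _ _⟩⟩⟩
  have hsplit₂ : IsSplitEpi (pullback.snd q q) :=
    ⟨⟨⟨pullback.lift (𝟙 _) (𝟙 _) rfl, pullback.lift_snd _ _ _⟩⟩⟩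
  have hproto : IsProtosplitMono j :=
    ⟨_, _, hsplit₁, isKernelOf_iff.2 ⟨hj, hj₁, fun t ht =>
      let ⟨u, hu, _⟩ := hker t ht; ⟨u, hu⟩⟩⟩
  let r (N : Subobject X) := (Subobject.pullback (K ⊔ L).arrow).obj N
  have hr {N : Subobject X} (hN : IsNormalSubobject N) :
      IsNormalSubobject ((Subobject.map j).obj (r N)) := by
    rw [isNormalSubobject_iff] at hN ⊢
    obtain ⟨D, g, hg⟩ := hN
    -- With `g` a morphism whose kernel is `N`, this morphism kills exactly the pairs `(0, y)` with
    -- `y` in `N`.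
    refine ⟨X ⨯ D, prod.lift (pullback.fst q q) (pullback.snd q q ≫ g), fun {T} t => ?_⟩
    rw [map_factors_iff]
    constructor
    · rintro ⟨u, hu, rfl⟩
      rw [pullback_factors_iff, hg] at hu
      ext
      · simp [hj₁]
      · simpa [reassoc_of% hj₂] using hu
    · intro ht
      have h₁ : t ≫ pullback.fst q q = 0 := by simpa using congrArg (· ≫ prod.fst) ht
      have h₂ : t ≫ pullback.snd q q ≫ g = 0 := by simpa using congrArg (· ≫ prod.snd) ht
      obtain ⟨u, hu₁, hu₂⟩ := hker t h₁
      refine ⟨u, ?_, hu₁⟩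
      rw [pullback_factors_iff, hg, hu₂, Category.assoc, h₂]
  have hmap {N : Subobject X} (hN : N ≤ K ⊔ L) :
      (Subobject.map (K ⊔ L).arrow).obj (r N) = N := by
    refine le_antisymm ((map_le_iff _ _ _).2 le_rfl) ?_
    rw [le_iff_factors, map_factors_iff]
    exact ⟨Subobject.ofLE _ _ hN, by simp [r, pullback_factors_iff, factors_arrow], by simp⟩
  have htop : r K ⊔ r L = ⊤ := by
    have h : K ⊔ L ≤ (Subobject.map (K ⊔ L).arrow).obj (r K ⊔ r L) :=
      sup_le ((hmap le_sup_left).symm.le.trans ((Subobject.map _).monotone le_sup_left))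
        ((hmap le_sup_right).symm.le.trans ((Subobject.map _).monotone le_sup_right))
    have h' := (Subobject.pullback (K ⊔ L).arrow).monotone h
    rw [Subobject.pullback_map_self] at h'
    refine top_le_iff.1 (le_trans ?_ h')
    rw [← map_le_iff, Subobject.map_top, Subobject.mk_arrow]
  have h := (H _ _ j (r K) (r L) hproto (hr hK) (hr hL) htop).exists_obj (pullback.snd q q)
  rw [huqCommutator_eq_higginsCommutator
    (isNormalSubobject_higginsCommutator_of_sup_eq_top htop)] at h
  have heq : (Subobject.exists (pullback.snd q q)).obj
      ((Subobject.map j).obj (higginsCommutator (r K) (r L))) = higginsCommutator K L := by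
    have hm := map_higginsCommutator (K ⊔ L).arrow (r K) (r L)
    rw [hmap le_sup_left, hmap le_sup_right] at hm
    rw [← hm]
    refine eq_of_forall_ge_iff fun M => ?_
    rw [exists_le_iff, map_le_iff, map_le_iff, ← Subobject.pullback_comp, hj₂]
  exact heq ▸ h

end Commutators

/-! ### Normal subobjects of points and their kernels -/

namespace Pt

variable {C : Type u} [Category.{v} C] [HasZeroMorphisms C] [SemiAbelian C] {Z : C}

theorem isKernelOf_kerι (Y : Pt Z) : IsKernelOf (kerι Y) Y.p :=
  isKernelOf_kernel Y.p

theorem isProtosplitMono_kerι (Y : Pt Z) : IsProtosplitMono (kerι Y) :=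
  ⟨Z, Y.p, ⟨⟨⟨Y.s, Y.section_eq⟩⟩⟩, isKernelOf_kerι Y⟩

/-- A kernel in the category of points restricts to a kernel in the base category. -/
theorem map_kerSubobject_factors_iff {Y D : Pt Z} {K : Subobject Y} {g : Y ⟶ D}
    (h : IsKernelOf K.arrow g) {T : C} (t : T ⟶ Y.obj) :
    ((Subobject.map (kerι Y)).obj (kerSubobject K)).Factors t ↔ t ≫ Hom.hom g = 0 := by
  obtain ⟨-, w, hl⟩ := isKernelOf_iff.1 h
  have hw : Hom.hom K.arrow ≫ Hom.hom g = (K : Pt Z).p ≫ D.s := congrArg Hom.hom w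
  rw [kerSubobject, Subobject.map_mk, mk_factors_iff, ker_map_ι]
  constructor
  · rintro ⟨u, rfl⟩
    rw [Category.assoc, Category.assoc, hw, reassoc_of% kerι_p, zero_comp, comp_zero]
  · intro ht
    have htp : t ≫ Y.p = 0 := by rw [← g.comp_p, reassoc_of% ht, zero_comp]
    -- The free point on `T`: morphisms of points from it to `Y` correspond to morphisms from `T` to
    -- the kernel of `Y`, so the universal property in `Pt Z` can be applied to `t`.
    let P : Pt Z := ⟨Z ⨿ T, coprod.desc (𝟙 Z) 0, coprod.inl, coprod.inl_desc _ _⟩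
    let f : P ⟶ Y := ⟨coprod.desc Y.s t, by
      change _ = coprod.desc (𝟙 Z) 0
      rw [coprod.desc_comp, Y.section_eq, htp], coprod.inl_desc _ _⟩
    obtain ⟨u, hu⟩ := hl f (hom_ext (by
      change coprod.desc Y.s t ≫ Hom.hom g = coprod.desc (𝟙 Z) 0 ≫ D.s
      rw [coprod.desc_comp, coprod.desc_comp, ht, g.s_comp, Category.id_comp, zero_comp]))
    have hu' : Hom.hom u ≫ Hom.hom K.arrow = coprod.desc Y.s t := congrArg Hom.hom hu
    have hup : Hom.hom u ≫ (K : Pt Z).p = coprod.desc (𝟙 Z) 0 := u.comp_p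
    obtain ⟨l, hl⟩ := (isKernelOf_iff.1 (isKernelOf_kerι (K : Pt Z))).2.2 (coprod.inr ≫ Hom.hom u)
      (by rw [Category.assoc, hup, coprod.inr_desc])
    exact ⟨l, by rw [← Category.assoc, hl, Category.assoc, hu', coprod.inr_desc]⟩

theorem isNormalSubobject_map_kerSubobject {Y : Pt Z} {K : Subobject Y}
    (h : IsNormalSubobject K) :
    IsNormalSubobject ((Subobject.map (kerι Y)).obj (kerSubobject K)) := by
  obtain ⟨D, g, hg⟩ := h
  exact isNormalSubobject_iff.2 ⟨_, Hom.hom g, fun t => map_kerSubobject_factors_iff hg t⟩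

/-- A subobject of the kernel of a point which is normal in the point's total object comes from
a normal subobject of the point. -/
theorem exists_kerSubobject_eq {Y : Pt Z} {M : Subobject ((ker Z).obj Y)}
    (h : IsNormalSubobject ((Subobject.map (kerι Y)).obj M)) :
    ∃ N : Subobject Y, IsNormalSubobject N ∧ kerSubobject N = M := by
  obtain ⟨Q, q, -, ⟨w, ⟨hc⟩⟩, hq⟩ := h.exists_quotient
  have hYp : ((Subobject.map (kerι Y)).obj M).arrow ≫ Y.p = 0 := by
    obtain ⟨u, -, hu⟩ := (map_factors_iff _ _ _).1
      (factors_arrow ((Subobject.map (kerι Y)).obj M))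
    rw [← hu, Category.assoc, kerι_p, comp_zero]
  have hd : q ≫ hc.desc (CokernelCofork.ofπ Y.p hYp) = Y.p :=
    hc.fac (CokernelCofork.ofπ Y.p hYp) WalkingParallelPair.one
  let D : Pt Z := ⟨Q, hc.desc (CokernelCofork.ofπ Y.p hYp), Y.s ≫ q, by
    rw [Category.assoc, hd, Y.section_eq]⟩
  let g : Y ⟶ D := ⟨q, hd, rfl⟩
  -- The zero object of `Pt Z` is `Z` itself, so the kernel of `g` in points is the pullback of `q`
  -- along the section of `D`.
  let N : Pt Z := ⟨pullback q D.s, pullback.snd q D.s,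
    pullback.lift Y.s (𝟙 Z) (by simp [D]), pullback.lift_snd _ _ _⟩
  let n : N ⟶ Y := ⟨pullback.fst q D.s, by
    change pullback.fst q D.s ≫ Y.p = pullback.snd q D.s
    rw [← hd, pullback.condition_assoc]
    exact (congrArg _ D.section_eq).trans (Category.comp_id _), pullback.lift_fst _ _ _⟩
  have hs : Mono D.s := mono_of_mono_fac D.section_eq
  have hn : Mono n := ⟨fun a b hab => hom_ext ((cancel_mono (pullback.fst q D.s)).1
    (congrArg Hom.hom hab))⟩
  have hN : IsKernelOf (Subobject.mk n).arrow g := by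
    rw [factors_iff_of_isKernelOf]
    intro T t
    rw [mk_factors_iff]
    constructor
    · rintro ⟨u, rfl⟩
      refine hom_ext ?_
      change (Hom.hom u ≫ pullback.fst q D.s) ≫ q = T.p ≫ D.s
      rw [Category.assoc, pullback.condition, ← Category.assoc]
      exact congrArg (· ≫ D.s) u.comp_p
    · intro ht
      have ht' : Hom.hom t ≫ q = T.p ≫ D.s := congrArg Hom.hom ht
      refine ⟨⟨pullback.lift (Hom.hom t) T.p ht', pullback.lift_snd _ _ _, ?_⟩,
        hom_ext (pullback.lift_fst _ _ _)⟩
      change T.s ≫ _ = pullback.lift Y.s (𝟙 Z) _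
      ext
      · simpa using t.s_comp
      · simpa using T.section_eq
  refine ⟨Subobject.mk n, ⟨D, g, hN⟩, Subobject.map_obj_injective (kerι Y) ?_⟩
  refine le_antisymm ?_ ?_
  · rw [le_iff_factors, hq]
    exact (map_kerSubobject_factors_iff hN _).1 (factors_arrow _)
  · rw [le_iff_factors, map_kerSubobject_factors_iff hN]
    exact w

end Pt

variable {C : Type u} [Category.{v} C] [HasZeroMorphisms C] [SemiAbelian C]

theorem map_sup_eq_top {X Y : C} (e : X ⟶ Y) [IsIso e] {K L : Subobject X} (h : K ⊔ L = ⊤) :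
    (Subobject.map e).obj K ⊔ (Subobject.map e).obj L = ⊤ := by
  have := (Subobject.mapIsoToOrderIso (asIso e)).map_sup K L
  rw [h, OrderIso.map_top] at this
  exact this.symm

/-- Normality of Huq commutators of subobjects spanning a protosplit normal subobject can be tested
on kernels of points. -/
theorem isNormalSubobject_map_huqCommutator_of_pt
    (H : ∀ (Z : C) (Y : Pt Z) (K L : Subobject ((Pt.ker Z).obj Y)),
      IsNormalSubobject ((Subobject.map (Pt.kerι Y)).obj K) →
      IsNormalSubobject ((Subobject.map (Pt.kerι Y)).obj L) → K ⊔ L = ⊤ →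
      IsNormalSubobject ((Subobject.map (Pt.kerι Y)).obj (huqCommutator K L)))
    {X Y : C} (x : X ⟶ Y) [Mono x] {K L : Subobject X} (hx : IsProtosplitMono x)
    (hK : IsNormalSubobject ((Subobject.map x).obj K))
    (hL : IsNormalSubobject ((Subobject.map x).obj L)) (h : K ⊔ L = ⊤) :
    IsNormalSubobject ((Subobject.map x).obj (huqCommutator K L)) := by
  obtain ⟨Z, p, ⟨⟨⟨s, hs⟩⟩⟩, hx⟩ := hx
  let P : Pt Z := ⟨Y, p, s, hs⟩
  obtain ⟨e, he, hex⟩ := hx.exists_iso (Pt.isKernelOf_kerι P)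
  have hmap (N : Subobject X) : (Subobject.map x).obj N =
      (Subobject.map (Pt.kerι P)).obj ((Subobject.map e).obj N) := by
    rw [← Subobject.map_comp]
    congr 2
    exact hex.symm
  rw [hmap] at hK hL ⊢
  rw [(map_huqCommutator_eq_iff e K L).2
    (isNormalSubobject_map_iso e (isNormalSubobject_huqCommutator K L))]
  exact H Z P _ _ hK hL (map_sup_eq_top e h)

end HuqHiggins

end

/-! ### The equivalences -/

theorem mainTheorem2 {C : Type u} [Category.{v} C] [HasZeroMorphisms C]
    [HuqHiggins.SemiAbelian C] :
    -- the Huq commutator always exists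
    (∀ (X : C) (K L : Subobject X),
      HuqHiggins.IsHuqCommutator K L (HuqHiggins.huqCommutator K L)) ∧
    List.TFAE [
      -- (i)
      HuqHiggins.ConditionNH C,
      -- (ii)
      ∀ (X Y : C) (x : X ⟶ Y) [Mono x] (K L : Subobject X),
        HuqHiggins.IsNormalSubobject ((Subobject.map x).obj K) →
        HuqHiggins.IsNormalSubobject ((Subobject.map x).obj L) →
        (Subobject.map x).obj (HuqHiggins.huqCommutator K L) =
          HuqHiggins.huqCommutator ((Subobject.map x).obj K) ((Subobject.map x).obj L),
      -- (iii)
      ∀ (X Y : C) (x : X ⟶ Y) [Mono x] (K L : Subobject X),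
        HuqHiggins.IsNormalMono x →
        HuqHiggins.IsNormalSubobject ((Subobject.map x).obj K) →
        HuqHiggins.IsNormalSubobject ((Subobject.map x).obj L) →
        (Subobject.map x).obj (HuqHiggins.huqCommutator K L) =
          HuqHiggins.huqCommutator ((Subobject.map x).obj K) ((Subobject.map x).obj L),
      -- (iv)
      ∀ (X Y : C) (x : X ⟶ Y) [Mono x] (K L : Subobject X),
        HuqHiggins.IsProtosplitMono x →
        HuqHiggins.IsNormalSubobject ((Subobject.map x).obj K) →
        HuqHiggins.IsNormalSubobject ((Subobject.map x).obj L) →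
        (Subobject.map x).obj (HuqHiggins.huqCommutator K L) =
          HuqHiggins.huqCommutator ((Subobject.map x).obj K) ((Subobject.map x).obj L),
      -- (v)
      ∀ (X Y : C) (x : X ⟶ Y) [Mono x] (K L : Subobject X),
        HuqHiggins.IsNormalMono x →
        HuqHiggins.IsNormalSubobject ((Subobject.map x).obj K) →
        HuqHiggins.IsNormalSubobject ((Subobject.map x).obj L) →
        K ⊔ L = ⊤ →
        (Subobject.map x).obj (HuqHiggins.huqCommutator K L) =
          HuqHiggins.huqCommutator ((Subobject.map x).obj K) ((Subobject.map x).obj L),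
      -- (vi)
      ∀ (X Y : C) (x : X ⟶ Y) [Mono x] (K L : Subobject X),
        HuqHiggins.IsProtosplitMono x →
        HuqHiggins.IsNormalSubobject ((Subobject.map x).obj K) →
        HuqHiggins.IsNormalSubobject ((Subobject.map x).obj L) →
        K ⊔ L = ⊤ →
        (Subobject.map x).obj (HuqHiggins.huqCommutator K L) =
          HuqHiggins.huqCommutator ((Subobject.map x).obj K) ((Subobject.map x).obj L),
      -- (vii)
      ∀ (Z : C) (Y : HuqHiggins.Pt Z) (K' L' : Subobject Y),
        HuqHiggins.IsNormalSubobject K' → HuqHiggins.IsNormalSubobject L' →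
        ∃ N : Subobject Y, HuqHiggins.IsNormalSubobject N ∧
          HuqHiggins.Pt.kerSubobject N =
            HuqHiggins.huqCommutator (HuqHiggins.Pt.kerSubobject K')
              (HuqHiggins.Pt.kerSubobject L'),
      -- (viii)
      ∀ (Z : C) (Y : HuqHiggins.Pt Z) (K' L' : Subobject Y),
        HuqHiggins.IsNormalSubobject K' → HuqHiggins.IsNormalSubobject L' →
        HuqHiggins.Pt.kerSubobject K' ⊔ HuqHiggins.Pt.kerSubobject L' = ⊤ →
        ∃ N : Subobject Y, HuqHiggins.IsNormalSubobject N ∧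
          HuqHiggins.Pt.kerSubobject N =
            HuqHiggins.huqCommutator (HuqHiggins.Pt.kerSubobject K')
              (HuqHiggins.Pt.kerSubobject L')
    ] := by
  refine ⟨fun X K L => HuqHiggins.isHuqCommutator_huqCommutator K L, ?_⟩
  tfae_have 1 → 2 := by
    intro h X Y x _ K L hK hL
    -- The commutator is normal in `Y`, hence also in `X`, so there the Huq and Higgins commutators
    -- coincide.
    have hY := h Y _ _ hK hL
    rw [← HuqHiggins.map_higginsCommutator] at hY
    rwa [HuqHiggins.map_huqCommutator_eq_iff,
      HuqHiggins.huqCommutator_eq_higginsCommutator (hY.of_map x)]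
  tfae_have 2 → 3 := fun h X Y x _ K L _ => h X Y x K L
  tfae_have 3 → 4 := fun h X Y x _ K L hx => h X Y x K L hx.isNormalMono
  tfae_have 3 → 5 := fun h X Y x _ K L hx hK hL _ => h X Y x K L hx hK hL
  tfae_have 4 → 6 := fun h X Y x _ K L hx hK hL _ => h X Y x K L hx hK hL
  tfae_have 5 → 6 := fun h X Y x _ K L hx => h X Y x K L hx.isNormalMono
  tfae_have 6 → 1 := fun h => HuqHiggins.conditionNH_of_protosplit
    fun X Y x _ K L hx hK hL hKL =>
      (HuqHiggins.map_huqCommutator_eq_iff x K L).1 (h X Y x K L hx hK hL hKL)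
  tfae_have 4 → 7 := fun h Z Y K' L' hK hL =>
    HuqHiggins.Pt.exists_kerSubobject_eq ((HuqHiggins.map_huqCommutator_eq_iff _ _ _).1
      (h _ _ (HuqHiggins.Pt.kerι Y) _ _ (HuqHiggins.Pt.isProtosplitMono_kerι Y)
        (HuqHiggins.Pt.isNormalSubobject_map_kerSubobject hK)
        (HuqHiggins.Pt.isNormalSubobject_map_kerSubobject hL)))
  tfae_have 7 → 8 := fun h Z Y K' L' hK hL _ => h Z Y K' L' hK hL
  tfae_have 8 → 6 := by
    intro h X Y x _ K L hx hK hL hKL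
    rw [HuqHiggins.map_huqCommutator_eq_iff]
    refine HuqHiggins.isNormalSubobject_map_huqCommutator_of_pt ?_ x hx hK hL hKL
    intro Z Y K L hK hL hKL
    obtain ⟨K', hK', rfl⟩ := HuqHiggins.Pt.exists_kerSubobject_eq hK
    obtain ⟨L', hL', rfl⟩ := HuqHiggins.Pt.exists_kerSubobject_eq hL
    obtain ⟨N, hN, hNe⟩ := h Z Y K' L' hK' hL' hKL
    exact hNe ▸ HuqHiggins.Pt.isNormalSubobject_map_kerSubobject hN
  tfae_finish
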